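/- Let $G$ be a locally compact topological group that is (topologically) simple: it is non-trivial and its only closed normal subgroups are $\{1\}$ and $G$ (in particular $G$ may be any locally compact group that is simple as an abstract group). A semi-topological semi-group compactification of $G$ is a continuous semi-group homomorphism $\varphi\colon G\to S$ with dense image into a compact Hausdorff semi-group $S$ whose multiplication is separately continuous. $G$ is compactification-centric if for every such $\varphi$ and every $s\in S$ one has $s\varphi(G)=\varphi(G)s$. Let $\mathrm{WAP}(G)$ be the $C^*$-algebra of weakly almost periodic functions on $G$, that is, of those $f\in C_b(G)$ whose orbit under translation by $G$ is relatively compact in the weak topology of $C_b(G)$, and let $w(G)$, the WAP compactification, be its maximal ideal space, with the canonical map $\omega\colon G\to w(G)$ and the semi-topological semi-group structure extending the multiplication of $G$. $G$ satisfies the Mautner phenomenon if for every $s\in w(G)\setminus\omega(G)$ the subgroup $F_R(s)=\{g\in G : s\,\omega(g)=s\}$ is non-trivial. If $G$ is compactification-centric and satisfies the Mautner phenomenon, then $G$ has the Howe–Moore property: every (strongly continuous) unitary representation $(\pi,\mathcal H)$ of $G$ on a complex Hilbert space without non-zero invariant vectors is mixing, i.e. for all $u,v\in\mathcal H$ the matrix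 coefficient $g\mapsto\langle \pi(g)u,v\rangle$ belongs to $C_0(G)$. -/

import Mathlib

universe u v

open scoped BoundedContinuousFunction ZeroAtInfty

/-! ### Compactification-centric groups -/

/-- A semi-topological semi-group compactification of the topological group `G`: a continuous
semi-group homomorphism with dense image from `G` to the (compact Hausdorff semi-topological)
semi-group `S`. -/
structure IsSemigroupCompactification {G S : Type*} [Group G] [TopologicalSpace G]
    [Semigroup S] [TopologicalSpace S] [CompactSpace S] [T2Space S] [SeparatelyContinuousMul S]
    (φ : G →ₙ* S) : Prop where
  continuous : Continuous φ
  denseRange : DenseRange φ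

/-- `G` is compactification-centric if `s φ(G) = φ(G) s` for every semi-topological semi-group
compactification `φ : G → S` and every `s : S`. (Having a dense image of `G`, such an `S` is a
quotient of the set of ultrafilters on `G`, so the universe of `G` contains a copy of each `S`.) -/
def IsCompactificationCentric (G : Type u) [Group G] [TopologicalSpace G] : Prop :=
  ∀ (S : Type u) [Semigroup S] [TopologicalSpace S] [CompactSpace S] [T2Space S]
    [SeparatelyContinuousMul S] (φ : G →ₙ* S), IsSemigroupCompactification φ →
      ∀ s : S, (Set.range fun g : G => s * φ g) = Set.range fun g : G => φ g * s

/-! ### Weakly almost periodic functions and the WAP compactification -/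

section WAP

variable {G : Type*} [Group G] [TopologicalSpace G] [IsTopologicalGroup G]

/-- Translation of bounded continuous functions: `(rightTranslate g f) x = f (x * g)`. -/
noncomputable def rightTranslate (g : G) : (G →ᵇ ℂ) →⋆ₐ[ℂ] (G →ᵇ ℂ) where
  toFun f := f.compContinuous ⟨fun x => x * g, continuous_mul_const g⟩
  map_one' := rfl
  map_mul' _ _ := rfl
  map_zero' := rfl
  map_add' _ _ := rfl
  commutes' _ := rfl
  map_star' _ := rfl

@[simp] theorem rightTranslate_apply (g : G) (f : G →ᵇ ℂ) (x : G) :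
    rightTranslate g f x = f (x * g) := rfl

theorem rightTranslate_rightTranslate (g h : G) (f : G →ᵇ ℂ) :
    rightTranslate g (rightTranslate h f) = rightTranslate (g * h) f := by
  ext x; simp [mul_assoc]

theorem continuous_rightTranslate (g : G) : Continuous (rightTranslate (G := G) g) :=
  BoundedContinuousFunction.continuous_compContinuous _

/-- `f` is weakly almost periodic if its `G`-orbit is relatively compact in the weak topology of
the Banach space of bounded continuous functions. -/
def IsWeaklyAlmostPeriodic (f : G →ᵇ ℂ) : Prop :=
  IsCompact (closure (toWeakSpace ℂ (G →ᵇ ℂ) '' Set.range fun g : G => rightTranslate g f))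

theorem IsWeaklyAlmostPeriodic.rightTranslate {f : G →ᵇ ℂ} (hf : IsWeaklyAlmostPeriodic f)
    (g : G) : IsWeaklyAlmostPeriodic (rightTranslate g f) := by
  have h : (Set.range fun k : G => _root_.rightTranslate k (_root_.rightTranslate g f)) =
      Set.range fun k : G => _root_.rightTranslate k f := by
    simp only [rightTranslate_rightTranslate]
    exact (Equiv.mulRight g).surjective.range_comp fun k : G => _root_.rightTranslate k f
  unfold IsWeaklyAlmostPeriodic at hf ⊢
  rwa [h]

variable (G) in
/-- The `C*`-algebra `WAP(G)`, as the closed unital `*`-subalgebra of `C_b(G)` generated by the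
weakly almost periodic functions. (These functions are themselves a closed unital
`*`-subalgebra, so nothing is added; generating makes it an algebra by construction.) -/
noncomputable def wapAlgebra : StarSubalgebra ℂ (G →ᵇ ℂ) :=
  (StarAlgebra.adjoin ℂ {f : G →ᵇ ℂ | IsWeaklyAlmostPeriodic f}).topologicalClosure

theorem isClosed_wapAlgebra : IsClosed (wapAlgebra G : Set (G →ᵇ ℂ)) :=
  StarSubalgebra.isClosed_topologicalClosure _

instance : IsClosed (wapAlgebra G : Set (G →ᵇ ℂ)) := isClosed_wapAlgebra

theorem IsWeaklyAlmostPeriodic.mem_wapAlgebra {f : G →ᵇ ℂ} (hf : IsWeaklyAlmostPeriodic f) :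
    f ∈ wapAlgebra G :=
  StarSubalgebra.le_topologicalClosure _ (StarAlgebra.subset_adjoin ℂ _ hf)

theorem rightTranslate_mem_wapAlgebra (g : G) {f : G →ᵇ ℂ} (hf : f ∈ wapAlgebra G) :
    rightTranslate g f ∈ wapAlgebra G := by
  have h : StarAlgebra.adjoin ℂ {f : G →ᵇ ℂ | IsWeaklyAlmostPeriodic f} ≤
      (wapAlgebra G).comap (rightTranslate g) :=
    StarAlgebra.adjoin_le fun f hf => (hf.rightTranslate g).mem_wapAlgebra
  exact StarSubalgebra.topologicalClosure_minimal h
    (isClosed_wapAlgebra.preimage (continuous_rightTranslate g)) hf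

/-- Right translation as an endomorphism of `WAP(G)`. -/
noncomputable def wapTranslate (g : G) : wapAlgebra G →⋆ₐ[ℂ] wapAlgebra G :=
  ((rightTranslate g).comp (wapAlgebra G).subtype).codRestrict (wapAlgebra G)
    fun f => rightTranslate_mem_wapAlgebra g f.2

@[simp] theorem coe_wapTranslate (g : G) (f : wapAlgebra G) :
    (wapTranslate g f : G →ᵇ ℂ) = rightTranslate g (f : G →ᵇ ℂ) := rfl

variable (G) in
/-- The WAP compactification `w(G)`: the maximal ideal space (space of characters with the weak-*
topology) of `WAP(G)`. -/
abbrev WAPCompactification : Type _ := WeakDual.characterSpace ℂ (wapAlgebra G)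

/-- The canonical map `ω : G → w(G)`, sending `x` to the evaluation at `x`. -/
noncomputable def toWAPCompactification (x : G) : WAPCompactification G :=
  WeakDual.CharacterSpace.equivAlgHom.symm
    { toFun := fun f => (f : G →ᵇ ℂ) x
      map_one' := rfl
      map_mul' := fun _ _ => rfl
      map_zero' := rfl
      map_add' := fun _ _ => rfl
      commutes' := fun _ => rfl }

@[simp] theorem toWAPCompactification_apply (x : G) (f : wapAlgebra G) :
    toWAPCompactification x f = (f : G →ᵇ ℂ) x := rfl

/-- The product `s · ω(g)` in the semi-group `w(G)`, for `s` in `w(G)` and `g` in `G`: it is the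
character `f ↦ s (x ↦ f (x * g))`. By the next three facts it is the only map `w(G) → w(G)` that
is continuous in `s` and satisfies `ω(x) · ω(g) = ω(x * g)`. -/
noncomputable def wapMulRight (s : WAPCompactification G) (g : G) : WAPCompactification G :=
  WeakDual.CharacterSpace.compContinuousMap (wapTranslate g) s

@[simp] theorem wapMulRight_apply (s : WAPCompactification G) (g : G) (f : wapAlgebra G) :
    wapMulRight s g f = s (wapTranslate g f) := rfl

theorem continuous_wapMulRight (g : G) :
    Continuous fun s : WAPCompactification G => wapMulRight s g :=
  (WeakDual.CharacterSpace.compContinuousMap (wapTranslate g)).continuous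

theorem wapMulRight_toWAPCompactification (x g : G) :
    wapMulRight (toWAPCompactification x) g = toWAPCompactification (x * g) := rfl

theorem denseRange_toWAPCompactification :
    DenseRange (toWAPCompactification : G → WAPCompactification G) := by
  intro s
  by_contra hs
  obtain ⟨F, hF0, hF1, -⟩ := exists_continuous_zero_one_of_isClosed
    (isClosed_closure (s := Set.range (toWAPCompactification (G := G)))) isClosed_singleton
    (Set.disjoint_singleton_right.mpr hs)
  let F' : C(WAPCompactification G, ℂ) := ⟨fun t => (F t : ℂ), by fun_prop⟩
  obtain ⟨f, hf⟩ := (gelfandTransform_bijective (wapAlgebra G)).2 F'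
  have h (t : WAPCompactification G) : t f = (F t : ℂ) := DFunLike.congr_fun hf t
  have hf0 : f = 0 := by
    ext x
    have hx : F (toWAPCompactification x) = 0 := hF0 (subset_closure ⟨x, rfl⟩)
    have := h (toWAPCompactification x)
    rw [hx] at this
    simpa using this
  have h1 := h s
  rw [hF1 rfl, hf0] at h1
  simp at h1

theorem wapMulRight_one (s : WAPCompactification G) : wapMulRight s 1 = s := by
  ext f
  rw [wapMulRight_apply]
  congr 1
  ext x
  simp

theorem wapMulRight_mul (s : WAPCompactification G) (g h : G) :
    wapMulRight s (g * h) = wapMulRight (wapMulRight s g) h := by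
  ext f
  simp only [wapMulRight_apply]
  congr 1
  ext x
  simp [mul_assoc]

/-- The subgroup `F_R(s) = {g : s · ω(g) = s}` of right fixed points of `s`. -/
def wapFixRight (s : WAPCompactification G) : Subgroup G where
  carrier := {g | wapMulRight s g = s}
  one_mem' := wapMulRight_one s
  mul_mem' {g h} hg hh := by
    simp only [Set.mem_ofPred_eq] at hg hh ⊢
    rw [wapMulRight_mul, hg, hh]
  inv_mem' {g} hg := by
    simp only [Set.mem_ofPred_eq] at hg ⊢
    conv_lhs => rw [← hg]
    rw [← wapMulRight_mul, mul_inv_cancel, wapMulRight_one]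

variable (G) in
/-- The Mautner phenomenon: `F_R(s)` is non-trivial for every `s` in `w(G) \ G`. -/
def HasMautnerPhenomenon : Prop :=
  ∀ s : WAPCompactification G, s ∉ Set.range (toWAPCompactification (G := G)) →
    wapFixRight s ≠ ⊥

end WAP

/-! ### Simple topological groups, unitary representations, the Howe–Moore property -/

/-- A topological group is topologically simple if it is non-trivial and has no closed normal
subgroups besides the trivial one and itself. -/
structure IsTopologicallySimple (G : Type*) [Group G] [TopologicalSpace G] : Prop where
  nontrivial : Nontrivial G
  eq_bot_or_eq_top : ∀ N : Subgroup G, N.Normal → IsClosed (N : Set G) → N = ⊥ ∨ N = ⊤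

/-- A group that is simple as an abstract group is in particular topologically simple. -/
theorem IsTopologicallySimple.of_isSimpleGroup (G : Type*) [Group G] [TopologicalSpace G]
    [IsSimpleGroup G] : IsTopologicallySimple G :=
  ⟨inferInstance, fun _ hN _ => hN.eq_bot_or_eq_top⟩

/-- A unitary representation of `G` on the Hilbert space `H`: a strongly continuous homomorphism
to the unitary group of `H`. -/
structure UnitaryRepresentation (G : Type*) [Group G] [TopologicalSpace G]
    (H : Type*) [NormedAddCommGroup H] [InnerProductSpace ℂ H] [CompleteSpace H] where
  toHom : G →* unitary (H →L[ℂ] H)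
  continuous_apply : ∀ v : H, Continuous fun g : G => (toHom g : H →L[ℂ] H) v

namespace UnitaryRepresentation

variable {G : Type*} [Group G] [TopologicalSpace G]
  {H : Type*} [NormedAddCommGroup H] [InnerProductSpace ℂ H] [CompleteSpace H]

/-- The matrix coefficient `g ↦ ⟪v, π(g) u⟫`, for the inner product of `H`. -/
noncomputable def matrixCoeff (π : UnitaryRepresentation G H) (u v : H) (g : G) : ℂ :=
  InnerProductSpace.toInner.inner (𝕜 := ℂ) v ((π.toHom g : H →L[ℂ] H) u)

/-- `π` has no invariant vectors besides `0`. -/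
def HasNoInvariantVectors (π : UnitaryRepresentation G H) : Prop :=
  ∀ v : H, (∀ g : G, (π.toHom g : H →L[ℂ] H) v = v) → v = 0

/-- `π` is mixing: all its matrix coefficients belong to `C₀(G)`. -/
def IsMixing (π : UnitaryRepresentation G H) : Prop :=
  ∀ u v : H, ∃ f : C₀(G, ℂ), (f : G → ℂ) = π.matrixCoeff u v

end UnitaryRepresentation

/-- The Howe–Moore property: every unitary representation without (non-zero) invariant vectors is
mixing. Here `v` is the universe of the Hilbert spaces. -/
def HasHoweMooreProperty (G : Type u) [Group G] [TopologicalSpace G] : Prop :=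
  ∀ (H : Type v) [NormedAddCommGroup H] [InnerProductSpace ℂ H] [CompleteSpace H]
    (π : UnitaryRepresentation G H), π.HasNoInvariantVectors → π.IsMixing

/-!
Let `π` be a unitary representation of `G` without invariant vectors, and let `S` be the closure of
`π(G)` in the weak operator topology. Balls of operators are compact in this topology and
multiplication is separately continuous, so `S` is a semi-topological semi-group compactification
of `G`. For `T` in `S`, the right stabilizer `{g | T π(g) = T}` is closed, and it is normal because
`S` satisfies `T π(G) = π(G) T` (`UnitaryRepresentation.normal_wotFixRight`). As `G` is simple, the
stabilizer is trivial or all of `G`; in the latter case the range of `T*` consists of invariant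
vectors, so `T = 0` (`UnitaryRepresentation.eq_zero_of_wotFixRight_eq_top`).

The Mautner phenomenon excludes the trivial stabilizer for the limits at infinity. Matrix
coefficients of unitary representations are weakly almost periodic, since their orbits are images
of bounded subsets of a Hilbert space under a bounded operator
(`UnitaryRepresentation.isWeaklyAlmostPeriodic_coeffCLM`). Hence if an ultrafilter on `G` has the
limit `s` in `w(G)` and the limit `T` in `S`, then `s` determines `T`, and `F_R(s)` is contained in
the stabilizer of `T` (`UnitaryRepresentation.wapFixRight_le_wotFixRight`). Finally, `s` is not a
point of `G` if the ultrafilter goes to infinity: among the matrix coefficients of the regular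
representation, and so in `WAP(G)`, there is a function that is non-zero at `1` and vanishes off a
compact set
(`not_tendsto_cocompact_toWAPCompactification`). So `π(g)` tends weakly to `0` at infinity.
-/

open Filter Topology

/-! ### Compactifications in arbitrary universes -/

/-- The target of a compactification is the image of the set of ultrafilters on `G`. -/
theorem IsSemigroupCompactification.small {G : Type u} {S : Type v} [Group G] [TopologicalSpace G]
    [Semigroup S] [TopologicalSpace S] [CompactSpace S] [T2Space S] [SeparatelyContinuousMul S]
    {φ : G →ₙ* S} (hφ : IsSemigroupCompactification φ) : Small.{u} S := by
  have hsurj : Function.Surjective (Ultrafilter.extend φ) := by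
    intro s
    obtain ⟨U, hU, hs⟩ := mem_closure_iff_ultrafilter.1 (hφ.denseRange s)
    obtain ⟨V, rfl⟩ : ∃ V : Ultrafilter G, V.map φ = U := by
      refine ⟨Ultrafilter.ofComapInfPrincipal (m := φ) (s := Set.univ) (g := U)
        (by simpa using hU), ?_⟩
      exact Ultrafilter.ofComapInfPrincipal_eq_of_map (by simpa using hU)
    exact ⟨V, ultrafilter_extend_eq_iff.2 hs⟩
  exact small_of_surjective hsurj

/-- Compactification-centricity, stated for semi-groups in the universe of the group, applies to
compactifications in every universe, as these can be shrunk. -/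
theorem IsCompactificationCentric.range_mul_eq {G : Type u} {S : Type v} [Group G]
    [TopologicalSpace G] [Semigroup S] [TopologicalSpace S] [CompactSpace S] [T2Space S]
    [SeparatelyContinuousMul S] (hG : IsCompactificationCentric G) {φ : G →ₙ* S}
    (hφ : IsSemigroupCompactification φ) (s : S) :
    (Set.range fun g : G => s * φ g) = Set.range fun g : G => φ g * s := by
  have := hφ.small
  let e : S ≃ₜ Shrink.{u} S := Shrink.homeomorph S
  let m : S ≃* Shrink.{u} S := Shrink.mulEquiv.symm
  have hem : ∀ x, e x = m x := fun _ => rfl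
  have : CompactSpace (Shrink.{u} S) := e.compactSpace
  have : T2Space (Shrink.{u} S) := e.t2Space
  have hmul : ∀ x y : Shrink.{u} S, x * y = e (e.symm x * e.symm y) := fun _ _ => rfl
  have : SeparatelyContinuousMul (Shrink.{u} S) := by
    constructor
    · intro a
      simp only [hmul]
      exact e.continuous.comp ((continuous_const_mul _).comp e.symm.continuous)
    · intro a
      simp only [hmul]
      exact e.continuous.comp ((continuous_mul_const _).comp e.symm.continuous)
  have key := hG (Shrink.{u} S) ((m : S →ₙ* Shrink.{u} S).comp φ)
    ⟨e.continuous.comp hφ.continuous, e.surjective.denseRange.comp hφ.denseRange e.continuous⟩ (m s)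
  have h1 : (fun g : G => m s * ((m : S →ₙ* Shrink.{u} S).comp φ) g) =
      m ∘ fun g => s * φ g := by ext g; simp
  have h2 : (fun g : G => ((m : S →ₙ* Shrink.{u} S).comp φ) g * m s) =
      m ∘ fun g => φ g * s := by ext g; simp
  rw [h1, h2, Set.range_comp, Set.range_comp] at key
  exact m.injective.image_injective key

/-! ### Weak compactness in Hilbert spaces -/

section Hilbert

variable {H : Type*} [NormedAddCommGroup H] [InnerProductSpace ℂ H] [CompleteSpace H]

/-- Closed balls of a Hilbert space are weakly compact: the Riesz isomorphism carries the weak-*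
topology of the dual to the weak topology. -/
theorem isCompact_toWeakSpace_image_closedBall (r : ℝ) :
    IsCompact (toWeakSpace ℂ H '' Metric.closedBall 0 r) := by
  let R : WeakDual ℂ H → WeakSpace ℂ H := fun x' =>
    toWeakSpace ℂ H ((InnerProductSpace.toDual ℂ H).symm (WeakDual.toStrongDual x'))
  have hR : Continuous R := by
    refine WeakBilin.continuous_of_continuous_eval _ fun f => ?_
    have h : (fun x' => (topDualPairing ℂ H).flip (R x') f) =
        fun x' : WeakDual ℂ H => star (x' ((InnerProductSpace.toDual ℂ H).symm f)) := by
      ext x'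
      change f ((InnerProductSpace.toDual ℂ H).symm (WeakDual.toStrongDual x')) = _
      rw [← InnerProductSpace.toDual_symm_apply, ← inner_conj_symm,
        InnerProductSpace.toDual_symm_apply]
      rfl
    change Continuous (fun x' => (topDualPairing ℂ H).flip (R x') f)
    rw [h]
    exact continuous_star.comp (WeakDual.eval_continuous _)
  convert (WeakDual.isCompact_closedBall (𝕜 := ℂ) (E := H) 0 r).image hR using 1
  ext x
  constructor
  · rintro ⟨y, hy, rfl⟩
    refine ⟨StrongDual.toWeakDual (InnerProductSpace.toDual ℂ H y), ?_, ?_⟩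
    · simpa using hy
    · exact congrArg (toWeakSpace ℂ H) ((InnerProductSpace.toDual ℂ H).symm_apply_apply y)
  · rintro ⟨x', hx', rfl⟩
    exact ⟨_, by simpa using hx', rfl⟩

/-- Closed balls are compact in the weak operator topology: along an ultrafilter the sesquilinear
forms of the operators converge pointwise to a bounded sesquilinear form. -/
theorem ContinuousLinearMapWOT.isCompact_setOf_norm_le (r : ℝ) :
    IsCompact {A : H →WOT[ℂ] H | ‖A.toCLM‖ ≤ r} := by
  rw [isCompact_iff_ultrafilter_le_nhds]
  intro U hU
  rw [le_principal_iff] at hU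
  have hbound (x y : H) : ∀ᶠ A : H →WOT[ℂ] H in U, inner ℂ (A x) y ∈
      Metric.closedBall (0 : ℂ) (r * ‖x‖ * ‖y‖) := by
    filter_upwards [hU] with A hA
    rw [mem_closedBall_zero_iff]
    refine (norm_inner_le_norm _ _).trans ?_
    gcongr
    exact A.toCLM.le_of_opNorm_le hA x
  have hex (x y : H) : ∃ c : ℂ, ‖c‖ ≤ r * ‖x‖ * ‖y‖ ∧
      Tendsto (fun A : H →WOT[ℂ] H => inner ℂ (A x) y) U (𝓝 c) := by
    obtain ⟨c, hc, h⟩ := isCompact_iff_ultrafilter_le_nhds'.1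
      (isCompact_closedBall (0 : ℂ) (r * ‖x‖ * ‖y‖)) (U.map fun A : H →WOT[ℂ] H => inner ℂ (A x) y)
      (hbound x y)
    exact ⟨c, by simpa using hc, h⟩
  choose B hB hlim using hex
  let B' : H →L⋆[ℂ] H →L[ℂ] ℂ := LinearMap.mkContinuous₂
    (LinearMap.mk₂'ₛₗ (starRingEnd ℂ) (RingHom.id ℂ) B
      (fun x x' y => tendsto_nhds_unique (hlim _ y) (by
        simpa [inner_add_left] using (hlim x y).add (hlim x' y)))
      (fun c x y => tendsto_nhds_unique (hlim _ y) (by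
        simpa [inner_smul_left, mul_comm] using (hlim x y).const_mul (starRingEnd ℂ c)))
      (fun x y y' => tendsto_nhds_unique (hlim x _) (by
        simpa [inner_add_right] using (hlim x y).add (hlim x y')))
      (fun c x y => tendsto_nhds_unique (hlim x _) (by
        simpa [inner_smul_right] using (hlim x y).const_mul c))) r hB
  let T : H →WOT[ℂ] H := .ofCLM (InnerProductSpace.continuousLinearMapOfBilin B')
  have hT (x y : H) : inner ℂ (T x) y = B x y :=
    InnerProductSpace.continuousLinearMapOfBilin_apply B' x y
  have hr : 0 ≤ r := by
    obtain ⟨A, hA⟩ := U.nonempty_of_mem hU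
    exact (norm_nonneg _).trans hA
  refine ⟨T, ContinuousLinearMap.opNorm_le_bound _ hr fun x => ?_, ?_⟩
  -- The norm bound: `‖T x‖ ^ 2 = B x (T x) ≤ r * ‖x‖ * ‖T x‖`.
  · rcases (norm_nonneg (T x)).eq_or_lt with h | h
    · change ‖T x‖ ≤ _
      rw [← h]; positivity
    · refine le_of_mul_le_mul_right ?_ h
      have := hB x (T x)
      rwa [← hT, inner_self_eq_norm_sq_to_K, norm_pow, RCLike.norm_ofReal, abs_norm, sq] at this
  · refine ContinuousLinearMapWOT.le_nhds_iff_forall_inner_apply_le_nhds.2 fun x y => ?_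
    have h := (continuous_star.tendsto _).comp (hlim x y)
    rw [← hT] at h
    simpa [Function.comp_def, Tendsto] using h

end Hilbert

/-! ### Matrix coefficients are weakly almost periodic -/

namespace UnitaryRepresentation

variable {G : Type*} [Group G] [TopologicalSpace G]
  {H : Type*} [NormedAddCommGroup H] [InnerProductSpace ℂ H] [CompleteSpace H]

theorem continuous_matrixCoeff (π : UnitaryRepresentation G H) (u v : H) :
    Continuous (π.matrixCoeff u v) :=
  continuous_const.inner (π.continuous_apply u)

theorem norm_matrixCoeff_le (π : UnitaryRepresentation G H) (u v : H) (g : G) :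
    ‖π.matrixCoeff u v g‖ ≤ ‖v‖ * ‖u‖ :=
  (norm_inner_le_norm _ _).trans_eq (by rw [Unitary.norm_map])

theorem matrixCoeff_mul (π : UnitaryRepresentation G H) (u v : H) (x g : G) :
    π.matrixCoeff u v (x * g) = π.matrixCoeff ((π.toHom g : H →L[ℂ] H) u) v x := by
  simp [matrixCoeff]

/-- The bounded continuous function `g ↦ ⟪v, π(g) u⟫`, as a bounded linear function of `u`. -/
noncomputable def coeffCLM (π : UnitaryRepresentation G H) (v : H) : H →L[ℂ] G →ᵇ ℂ :=
  LinearMap.mkContinuous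
    { toFun := fun u => BoundedContinuousFunction.ofNormedAddCommGroup (π.matrixCoeff u v)
        (π.continuous_matrixCoeff u v) (‖v‖ * ‖u‖) (π.norm_matrixCoeff_le u v)
      map_add' := fun u u' => by ext g; simp [matrixCoeff, inner_add_right]
      map_smul' := fun c u => by ext g; simp [matrixCoeff, inner_smul_right] }
    ‖v‖ fun u => BoundedContinuousFunction.norm_ofNormedAddCommGroup_le _ (by positivity)
      (π.norm_matrixCoeff_le u v)

@[simp] theorem coeffCLM_apply (π : UnitaryRepresentation G H) (u v : H) (g : G) :
    π.coeffCLM v u g = π.matrixCoeff u v g := rfl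

/-- The orbit of a coefficient is the image of a bounded set under a bounded linear operator from
a Hilbert space, hence relatively weakly compact. -/
theorem isWeaklyAlmostPeriodic_coeffCLM [IsTopologicalGroup G] (π : UnitaryRepresentation G H)
    (u v : H) : IsWeaklyAlmostPeriodic (π.coeffCLM v u) := by
  have hK := (isCompact_toWeakSpace_image_closedBall (H := H) ‖u‖).image
    (WeakSpace.map (π.coeffCLM v)).continuous
  refine hK.closure_of_subset ?_
  rintro _ ⟨_, ⟨g, rfl⟩, rfl⟩
  refine ⟨_, ⟨(π.toHom g : H →L[ℂ] H) u, by simp [Unitary.norm_map], rfl⟩, ?_⟩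
  change toWeakSpace ℂ (G →ᵇ ℂ) (π.coeffCLM v ((π.toHom g : H →L[ℂ] H) u)) = _
  congr 1
  ext x
  simp [matrixCoeff_mul]

/-- The matrix coefficient `g ↦ ⟪v, π(g) u⟫` as an element of `WAP(G)`. -/
noncomputable def wapCoeff [IsTopologicalGroup G] (π : UnitaryRepresentation G H) (u v : H) :
    wapAlgebra G :=
  ⟨π.coeffCLM v u, (π.isWeaklyAlmostPeriodic_coeffCLM u v).mem_wapAlgebra⟩

@[simp] theorem coe_wapCoeff_apply [IsTopologicalGroup G] (π : UnitaryRepresentation G H)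
    (u v : H) (g : G) : (π.wapCoeff u v : G →ᵇ ℂ) g = π.matrixCoeff u v g := rfl

end UnitaryRepresentation

/-! ### The regular representation -/

section Regular

open MeasureTheory DomMulAct

variable (G : Type*) [Group G] [TopologicalSpace G] [IsTopologicalGroup G]
  [LocallyCompactSpace G] [MeasurableSpace G] [BorelSpace G]

/-- The left regular representation of a locally compact group on `L²` of its Haar measure,
`(λ(g) f)(x) = f (g⁻¹ x)`. The action of `Gᵈᵐᵃ` in Mathlib is by precomposition and without the
inverse. -/
noncomputable def regularRepresentation :
    UnitaryRepresentation G (Lp ℂ 2 (Measure.haar : Measure G)) where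
  toHom :=
    { toFun := fun g => Unitary.linearIsometryEquiv.symm
        { toFun := fun f => mk g⁻¹ • f
          invFun := fun f => mk g • f
          left_inv := fun f => by simp [smul_smul]
          right_inv := fun f => by simp [smul_smul]
          map_add' := fun f f' => smul_add _ f f'
          map_smul' := fun c f => smul_comm _ c f
          norm_map' := fun f => norm_smul_Lp _ f }
      map_one' := by
        ext1
        ext1 f
        change mk (1 : G)⁻¹ • f = f
        simp
      map_mul' := fun g h => by
        ext1
        ext1 f
        change mk (g * h)⁻¹ • f = mk g⁻¹ • mk h⁻¹ • f
        rw [smul_smul, ← mk_mul, mul_inv_rev] }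
  continuous_apply f := by
    change Continuous fun g : G => mk g⁻¹ • f
    have : Fact ((2 : ENNReal) ≠ ⊤) := ⟨by simp⟩
    have h : Continuous fun g : G => mk g⁻¹ := continuous_mk.comp continuous_inv
    exact h.smul continuous_const

theorem regularRepresentation_apply (g : G) (f : Lp ℂ 2 (Measure.haar : Measure G)) :
    ((regularRepresentation G).toHom g : _ →L[ℂ] _) f = mk g⁻¹ • f := rfl

end Regular

/-- The function is `g ↦ μ(K ∩ g K)` for a compact neighbourhood `K` of `1`, a matrix coefficient
of the regular representation. -/
theorem exists_mem_wapAlgebra_hasCompactSupport (G : Type*) [Group G] [TopologicalSpace G]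
    [IsTopologicalGroup G] [LocallyCompactSpace G] :
    ∃ f : wapAlgebra G, (f : G →ᵇ ℂ) 1 ≠ 0 ∧ ∀ᶠ g in cocompact G, (f : G →ᵇ ℂ) g = 0 := by
  let : MeasurableSpace G := borel G
  have : BorelSpace G := ⟨rfl⟩
  let μ : MeasureTheory.Measure G := .haar
  obtain ⟨K, hK1, hKcl, hK⟩ : ∃ K ∈ 𝓝 (1 : G), IsClosed K ∧ IsCompact K := by
    obtain ⟨K, hK, hK1⟩ := exists_compact_mem_nhds (1 : G)
    exact ⟨closure K, mem_of_superset hK1 subset_closure, isClosed_closure, hK.closure⟩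
  have hKμ : μ K ≠ ⊤ := hK.measure_ne_top
  let k : MeasureTheory.Lp ℂ 2 μ := MeasureTheory.indicatorConstLp 2 hKcl.measurableSet hKμ 1
  have hcoeff (g : G) : (regularRepresentation G).matrixCoeff k k g =
      μ.real (K ∩ (fun x => g⁻¹ * x) ⁻¹' K) := by
    rw [UnitaryRepresentation.matrixCoeff, regularRepresentation_apply]
    exact MeasureTheory.L2.inner_indicatorConstLp_one_indicatorConstLp_one hKcl.measurableSet
      (hKcl.measurableSet.preimage (measurable_const_mul g⁻¹)) hKμ
      (by rwa [MeasureTheory.measure_preimage_mul])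
  refine ⟨(regularRepresentation G).wapCoeff k k, ?_, ?_⟩
  · rw [UnitaryRepresentation.coe_wapCoeff_apply, hcoeff]
    simpa [MeasureTheory.measureReal_eq_zero_iff hKμ] using
      (MeasureTheory.Measure.measure_pos_of_mem_nhds μ hK1).ne'
  · refine mem_of_superset (hK.mul hK.inv).compl_mem_cocompact fun g hg => ?_
    have : K ∩ (fun x => g⁻¹ * x) ⁻¹' K = ∅ := by
      refine Set.eq_empty_of_forall_notMem fun x hx => hg ?_
      exact ⟨x, hx.1, x⁻¹ * g, by simpa using hx.2, by simp⟩
    change ((regularRepresentation G).wapCoeff k k : G →ᵇ ℂ) g = 0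
    rw [UnitaryRepresentation.coe_wapCoeff_apply, hcoeff, this]
    simp

/-- Points of `G` are not limits in `w(G)` of points going to infinity in `G`. -/
theorem not_tendsto_cocompact_toWAPCompactification {G : Type*} [Group G] [TopologicalSpace G]
    [IsTopologicalGroup G] [LocallyCompactSpace G] {U : Filter G} [U.NeBot]
    (hU : U ≤ cocompact G) (x : G) :
    ¬ Tendsto toWAPCompactification U (𝓝 (toWAPCompactification x)) := by
  intro h
  obtain ⟨f, hf1, hf⟩ := exists_mem_wapAlgebra_hasCompactSupport G
  have hev (f' : wapAlgebra G) : Tendsto (fun g => (f' : G →ᵇ ℂ) g) U (𝓝 ((f' : G →ᵇ ℂ) x)) :=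
    ((WeakDual.eval_continuous f').comp continuous_subtype_val).tendsto _ |>.comp h
  have h1 := hev (wapTranslate x⁻¹ f)
  have h2 : Tendsto (fun g => (wapTranslate x⁻¹ f : G →ᵇ ℂ) g) U (𝓝 0) := by
    refine tendsto_const_nhds.congr' ?_
    have := (Homeomorph.mulRight x⁻¹).isClosedEmbedding.tendsto_cocompact.eventually hf
    filter_upwards [hU this] with g hg
    exact hg.symm
  refine hf1 ?_
  have := tendsto_nhds_unique h1 h2
  simpa using this

/-! ### The operator compactification of a unitary representation -/

namespace UnitaryRepresentation

variable {G : Type*} [Group G] [TopologicalSpace G]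
  {H : Type*} [NormedAddCommGroup H] [InnerProductSpace ℂ H] [CompleteSpace H]

/-- A unitary representation as a homomorphism to the bounded operators with the weak operator
topology. -/
noncomputable def toWOT (π : UnitaryRepresentation G H) : G →* (H →WOT[ℂ] H) where
  toFun g := .ofCLM (π.toHom g)
  map_one' := by simp
  map_mul' g h := by simp

theorem toWOT_apply (π : UnitaryRepresentation G H) (g : G) (u : H) :
    π.toWOT g u = (π.toHom g : H →L[ℂ] H) u := rfl

theorem continuous_toWOT (π : UnitaryRepresentation G H) : Continuous π.toWOT :=
  ContinuousLinearMapWOT.continuous_iff.2 fun u v => π.continuous_matrixCoeff u v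

/-- The closure of `π(G)` in the weak operator topology. -/
noncomputable def wotClosure (π : UnitaryRepresentation G H) : Submonoid (H →WOT[ℂ] H) :=
  (MonoidHom.mrange π.toWOT).topologicalClosure

theorem coe_wotClosure (π : UnitaryRepresentation G H) :
    (π.wotClosure : Set (H →WOT[ℂ] H)) = closure (Set.range π.toWOT) := rfl

theorem toWOT_mem_wotClosure (π : UnitaryRepresentation G H) (g : G) :
    π.toWOT g ∈ π.wotClosure :=
  Submonoid.le_topologicalClosure _ ⟨g, rfl⟩

instance (π : UnitaryRepresentation G H) : CompactSpace π.wotClosure := by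
  refine isCompact_iff_compactSpace.1 (π.coe_wotClosure ▸
    (ContinuousLinearMapWOT.isCompact_setOf_norm_le 1).closure_of_subset ?_)
  rintro _ ⟨g, rfl⟩
  exact ContinuousLinearMap.opNorm_le_bound _ zero_le_one fun u => by
    rw [one_mul]; exact (Unitary.norm_map _ _).le

instance (π : UnitaryRepresentation G H) : SeparatelyContinuousMul π.wotClosure where
  continuous_const_mul := ((continuous_const_mul _).comp continuous_subtype_val).subtype_mk _
  continuous_mul_const := ((continuous_mul_const _).comp continuous_subtype_val).subtype_mk _

/-- `π`, corestricted to the weak operator closure of its image. -/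
noncomputable def toWOTClosure (π : UnitaryRepresentation G H) : G →ₙ* π.wotClosure :=
  (π.toWOT.codRestrict π.wotClosure π.toWOT_mem_wotClosure : G →* π.wotClosure)

theorem isSemigroupCompactification_toWOTClosure (π : UnitaryRepresentation G H) :
    IsSemigroupCompactification π.toWOTClosure where
  continuous := π.continuous_toWOT.subtype_mk _
  denseRange := by
    rw [denseRange_iff_closure_range, Set.eq_univ_iff_forall]
    rintro ⟨T, hT⟩
    rw [closure_subtype, ← Set.range_comp]
    exact hT

/-- The right stabilizer `{g | T π(g) = T}` of an operator `T`. -/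
def wotFixRight (π : UnitaryRepresentation G H) (T : H →WOT[ℂ] H) : Subgroup G where
  carrier := {g | T * π.toWOT g = T}
  one_mem' := by simp
  mul_mem' {g h} hg hh := by
    simp only [Set.mem_ofPred_eq] at hg hh ⊢
    rw [map_mul, ← mul_assoc, hg, hh]
  inv_mem' {g} hg := by
    simp only [Set.mem_ofPred_eq] at hg ⊢
    conv_lhs => rw [← hg]
    rw [mul_assoc, ← map_mul, mul_inv_cancel, map_one, mul_one]

theorem mem_wotFixRight {π : UnitaryRepresentation G H} {T : H →WOT[ℂ] H} {g : G} :
    g ∈ π.wotFixRight T ↔ T * π.toWOT g = T := Iff.rfl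

theorem isClosed_wotFixRight (π : UnitaryRepresentation G H) (T : H →WOT[ℂ] H) :
    IsClosed (π.wotFixRight T : Set G) :=
  isClosed_eq ((continuous_const_mul T).comp π.continuous_toWOT) continuous_const

/-- If `T π(h) = π(k) T` and `T π(g) = T`, then
`T π(h g h⁻¹) = π(k) T π(g) π(h⁻¹) = π(k) T π(h⁻¹) = T`. -/
theorem normal_wotFixRight (π : UnitaryRepresentation G H) (hG : IsCompactificationCentric G)
    {T : H →WOT[ℂ] H} (hT : T ∈ π.wotClosure) : (π.wotFixRight T).Normal where
  conj_mem g hg h := by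
    rw [mem_wotFixRight] at hg ⊢
    obtain ⟨k, hk⟩ : ∃ k, π.toWOT k * T = T * π.toWOT h := by
      obtain ⟨k, hk⟩ := (hG.range_mul_eq π.isSemigroupCompactification_toWOTClosure ⟨T, hT⟩).subset
        ⟨h, rfl⟩
      exact ⟨k, congrArg Subtype.val hk⟩
    calc T * π.toWOT (h * g * h⁻¹) = T * π.toWOT h * π.toWOT g * π.toWOT h⁻¹ := by
          simp only [map_mul, mul_assoc]
      _ = T * π.toWOT h * π.toWOT h⁻¹ := by rw [← hk, mul_assoc (π.toWOT k), hg]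
      _ = T := by rw [mul_assoc, ← map_mul, mul_inv_cancel, map_one, mul_one]

/-- If `T π(g) = T` for all `g`, then `π(g) T* = T*` for all `g`, so the range of `T*` consists of
invariant vectors. -/
theorem eq_zero_of_wotFixRight_eq_top {π : UnitaryRepresentation G H}
    (hπ : π.HasNoInvariantVectors) {T : H →WOT[ℂ] H} (hT : π.wotFixRight T = ⊤) : T = 0 := by
  have hadj (v : H) : ContinuousLinearMap.adjoint T.toCLM v = 0 := by
    refine hπ _ fun g => ext_inner_right ℂ fun w => ?_
    have hg : T * π.toWOT g⁻¹ = T := mem_wotFixRight.1 (hT ▸ Subgroup.mem_top g⁻¹)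
    have hw : (π.toHom g : H →L[ℂ] H) ((π.toHom g⁻¹ : H →L[ℂ] H) w) = w := by
      rw [← mul_apply_eq_comp]
      simp [← Submonoid.coe_mul]
    calc inner ℂ ((π.toHom g : H →L[ℂ] H) (ContinuousLinearMap.adjoint T.toCLM v)) w
        = inner ℂ (ContinuousLinearMap.adjoint T.toCLM v) ((π.toHom g⁻¹ : H →L[ℂ] H) w) := by
          conv_lhs => rw [← hw]
          exact Unitary.inner_map_map _ _ _
      _ = inner ℂ v (T (π.toWOT g⁻¹ w)) := ContinuousLinearMap.adjoint_inner_left _ _ _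
      _ = inner ℂ v (T w) := by rw [← ContinuousLinearMapWOT.mul_apply, hg]
      _ = _ := (ContinuousLinearMap.adjoint_inner_left _ _ _).symm
  refine ContinuousLinearMapWOT.ext_inner fun x y => ?_
  have := ContinuousLinearMap.adjoint_inner_left T.toCLM x y
  rw [hadj, inner_zero_left] at this
  simpa using this.symm

/-! ### The Howe–Moore property -/

variable [IsTopologicalGroup G]

/-- The limit in `w(G)` determines the weak operator limit: the coefficients of the latter are the
values of the former on the coefficients of `π`. -/
theorem inner_eq_of_tendsto_toWAPCompactification {π : UnitaryRepresentation G H} {U : Filter G}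
    [U.NeBot] {s : WAPCompactification G} (hs : Tendsto toWAPCompactification U (𝓝 s))
    {T : H →WOT[ℂ] H} (hT : Tendsto π.toWOT U (𝓝 T)) (u v : H) :
    inner ℂ v (T u) = s (π.wapCoeff u v) :=
  tendsto_nhds_unique (ContinuousLinearMapWOT.tendsto_iff_forall_inner_apply_tendsto.1 hT u v)
    (((WeakDual.eval_continuous (π.wapCoeff u v)).comp continuous_subtype_val).tendsto s |>.comp hs)

theorem wapFixRight_le_wotFixRight {π : UnitaryRepresentation G H} {U : Filter G}
    [U.NeBot] {s : WAPCompactification G} (hs : Tendsto toWAPCompactification U (𝓝 s))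
    {T : H →WOT[ℂ] H} (hT : Tendsto π.toWOT U (𝓝 T)) : wapFixRight s ≤ π.wotFixRight T := by
  intro g hg
  have hg : wapMulRight s g = s := hg
  refine mem_wotFixRight.2 (ContinuousLinearMapWOT.ext_inner fun u v => ?_)
  have htr : wapTranslate g (π.wapCoeff u v) =
      π.wapCoeff ((π.toHom g : H →L[ℂ] H) u) v := by
    ext x
    simp [matrixCoeff_mul]
  rw [ContinuousLinearMapWOT.mul_apply, toWOT_apply,
    inner_eq_of_tendsto_toWAPCompactification hs hT,
    inner_eq_of_tendsto_toWAPCompactification hs hT, ← htr, ← wapMulRight_apply, hg]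

/-- Along an ultrafilter whose limit `s` in `w(G)` is not a point of `G`, the operators `π(g)`
tend weakly to `0`: the right stabilizer of their limit is a closed normal subgroup and contains
`F_R(s)`, so it is all of `G`. -/
theorem tendsto_toWOT_zero {π : UnitaryRepresentation G H} (hπ : π.HasNoInvariantVectors)
    (hsimple : IsTopologicallySimple G) (hcentric : IsCompactificationCentric G)
    (hMautner : HasMautnerPhenomenon G) {U : Ultrafilter G} {s : WAPCompactification G}
    (hs : Tendsto toWAPCompactification U (𝓝 s))
    (hsG : s ∉ Set.range (toWAPCompactification (G := G))) : Tendsto π.toWOT U (𝓝 0) := by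
  obtain ⟨T, hTS, hT⟩ : ∃ T ∈ π.wotClosure, Tendsto π.toWOT U (𝓝 T) :=
    isCompact_iff_ultrafilter_le_nhds'.1 (isCompact_iff_compactSpace.2
      (inferInstanceAs (CompactSpace π.wotClosure))) (U.map π.toWOT)
      (Filter.mem_map.2 (univ_mem' π.toWOT_mem_wotClosure))
  have htop : π.wotFixRight T = ⊤ :=
    (hsimple.eq_bot_or_eq_top _ (π.normal_wotFixRight hcentric hTS)
      (π.isClosed_wotFixRight T)).resolve_left
      (ne_bot_of_le_ne_bot (hMautner s hsG) (wapFixRight_le_wotFixRight hs hT))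
  rwa [eq_zero_of_wotFixRight_eq_top hπ htop] at hT

end UnitaryRepresentation

theorem mainTheorem7 (G : Type u) [Group G] [TopologicalSpace G] [IsTopologicalGroup G]
    [LocallyCompactSpace G] (hsimple : IsTopologicallySimple G)
    (hcentric : IsCompactificationCentric G) (hMautner : HasMautnerPhenomenon G) :
    HasHoweMooreProperty.{u, v} G := by
  intro H _ _ _ π hπ u v
  refine ⟨⟨⟨π.matrixCoeff u v, π.continuous_matrixCoeff u v⟩,
    tendsto_iff_ultrafilter _ _ _ |>.2 fun U hU => ?_⟩, rfl⟩
  obtain ⟨s, hs⟩ : ∃ s, Tendsto (toWAPCompactification (G := G)) U (𝓝 s) :=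
    ⟨_, (U.map toWAPCompactification).le_nhds_lim⟩
  have hsG : s ∉ Set.range (toWAPCompactification (G := G)) := by
    rintro ⟨x, rfl⟩
    exact not_tendsto_cocompact_toWAPCompactification hU x hs
  have h0 := UnitaryRepresentation.tendsto_toWOT_zero hπ hsimple hcentric hMautner hs hsG
  have := ContinuousLinearMapWOT.tendsto_iff_forall_inner_apply_tendsto.1 h0 u v
  rwa [ContinuousLinearMapWOT.zero_apply, inner_zero_right] at this
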